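/- **Theorem (Minkowski 1887).** For every integer $n \ge 0$, the least common multiple of the orders of all finite subgroups of $\mathrm{GL}_n(\mathbb{Q})$ is $$ M(n) = \prod_{p} p^{\left\lfloor \frac{n}{p-1}\right\rfloor + \left\lfloor \frac{n}{p(p-1)}\right\rfloor + \left\lfloor \frac{n}{p^2(p-1)}\right\rfloor + \cdots}, $$ where $p$ runs over all primes (only finitely many factors differ from $1$, and in each exponent only finitely many terms are nonzero). That is, the order of every finite subgroup of $\mathrm{GL}_n(\mathbb{Q})$ divides $M(n)$, and $M(n)$ divides every natural number that is divisible by all these orders. -/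

import Mathlib

/-- `IsSetLCM S m`: the natural number `m` is the least common multiple of all members of the
(possibly infinite) set `S`, i.e. a common multiple that divides every common multiple. -/
def IsSetLCM (S : Set ℕ) (m : ℕ) : Prop :=
  (∀ s ∈ S, s ∣ m) ∧ ∀ k : ℕ, (∀ s ∈ S, s ∣ k) → m ∣ k

/-- The exponent `⌊n/(p-1)⌋ + ⌊n/(p(p-1))⌋ + ⌊n/(p²(p-1))⌋ + ⋯`, with floors of rational numbers;
only finitely many terms are nonzero when `p` is prime. -/
noncomputable def minkowskiExponent (n p : ℕ) : ℕ :=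
  ∑ᶠ k : ℕ, ⌊(n : ℚ) / ((p : ℚ) ^ k * ((p : ℚ) - 1))⌋₊

/-- The Minkowski number `M(n) = ∏_p p ^ (⌊n/(p-1)⌋ + ⌊n/(p(p-1))⌋ + ⌊n/(p²(p-1))⌋ + ⋯)`, the
product over all primes; only finitely many factors differ from `1`. -/
noncomputable def minkowskiNumber (n : ℕ) : ℕ :=
  ∏ᶠ p : Nat.Primes, (p : ℕ) ^ minkowskiExponent n p

/-- The orders of all finite groups of invertible `n × n` matrices over `ℚ`. -/
def finiteRationalMatrixGroupOrders (n : ℕ) : Set ℕ :=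
  {m | ∃ G : Subgroup (Matrix.GeneralLinearGroup (Fin n) ℚ), Finite G ∧ Nat.card G = m}

theorem minkowski_floor_eq (n k : ℕ) {p : ℕ} (hp : p.Prime) :
    ⌊(n : ℚ) / ((p : ℚ) ^ k * ((p : ℚ) - 1))⌋₊ = n / (p ^ k * (p - 1)) := by
  have h : (p : ℚ) ^ k * ((p : ℚ) - 1) = ((p ^ k * (p - 1) : ℕ) : ℚ) := by
    push_cast [hp.one_le]
    ring
  rw [h, Nat.floor_div_natCast, Nat.floor_natCast]

theorem minkowski_term_eq_zero {n k p : ℕ} (hp : p.Prime) (h : n ≤ k) :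
    ⌊(n : ℚ) / ((p : ℚ) ^ k * ((p : ℚ) - 1))⌋₊ = 0 := by
  rw [minkowski_floor_eq n k hp]
  apply Nat.div_eq_of_lt
  have h1 : k < p ^ k := Nat.lt_pow_self hp.one_lt
  have h2 : 1 ≤ p - 1 := Nat.le_sub_one_of_lt hp.one_lt
  nlinarith

/-- The sum defining the exponent has finitely many nonzero terms, so it is the finite sum
displayed here. -/
theorem minkowskiExponent_eq_sum (n : ℕ) {p : ℕ} (hp : p.Prime) :
    minkowskiExponent n p = ∑ k ∈ Finset.range n, n / (p ^ k * (p - 1)) := by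
  unfold minkowskiExponent
  rw [finsum_eq_sum_of_support_subset (s := Finset.range n)]
  · exact Finset.sum_congr rfl fun k _ => minkowski_floor_eq n k hp
  · intro k hk
    rw [Finset.coe_range, Set.mem_Iio]
    by_contra hkn
    exact hk (minkowski_term_eq_zero hp (not_lt.mp hkn))

/-- Primes `p > n + 1` contribute the factor `1`. -/
theorem minkowskiExponent_eq_zero {n p : ℕ} (hp : p.Prime) (h : n + 1 < p) :
    minkowskiExponent n p = 0 := by
  rw [minkowskiExponent_eq_sum n hp]
  refine Finset.sum_eq_zero fun k _ => Nat.div_eq_of_lt ?_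
  have h1 : 1 ≤ p ^ k := Nat.one_le_pow _ _ hp.pos
  have h2 : n < p - 1 := by omega
  nlinarith

/-- The product defining `M(n)` has finitely many factors different from `1`. -/
theorem minkowskiNumber_finite_mulSupport (n : ℕ) :
    (Function.mulSupport fun p : Nat.Primes => (p : ℕ) ^ minkowskiExponent n p).Finite := by
  refine Set.Finite.of_finite_image (f := fun p : Nat.Primes => (p : ℕ)) ?_
    Subtype.val_injective.injOn
  refine (Set.finite_Iic (n + 1)).subset ?_
  rintro _ ⟨p, hp, rfl⟩
  by_contra hlt
  exact hp (by simp [minkowskiExponent_eq_zero p.2 (not_le.mp hlt)])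

/-! Fix a prime p and put m = ⌊n/(p-1)⌋. The characteristic polynomial of a rational matrix of
p-power order is a product of `cyclotomic (p ^ j) ℚ`, whose root sums are 1, -1 and 0 for j = 0, j =
1 and j ≥ 2. So a non-identity element of a p-group has trace n - p * i with 1 ≤ i ≤ m. Blichfeldt's
argument: the product of the X - (n - p * i), evaluated at the character and summed over the group,
is a multiple of the group order; only the identity contributes, giving p^m * m!. By Legendre's
formula its p-part has the Minkowski exponent, and Sylow's theorem reduces the upper bound to
p-groups. The bound is attained: the wreath product of μ_p with S_m has order p^m * m! and acts
faithfully on ℚ(ζ_p)^m, of dimension m * (p - 1) ≤ n. -/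

/-! ### Traces of rational matrices of p-power order -/

open Polynomial in
/-- A monic rational polynomial of degree `d` whose roots have sum `d - p * i` for a natural number
`i ≤ d / (p - 1)`, with `i = 0` only for powers of `X - 1`. -/
def HasMinkowskiTrace (p : ℕ) (f : Polynomial ℚ) : Prop :=
  ∃ i : ℕ, -f.nextCoeff = f.natDegree - p * i ∧ (p - 1) * i ≤ f.natDegree ∧
    (i = 0 → f = (X - 1) ^ f.natDegree)

open Polynomial in
theorem hasMinkowskiTrace_one (p : ℕ) : HasMinkowskiTrace p 1 :=
  ⟨0, by simp [nextCoeff]⟩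

open Polynomial in
theorem HasMinkowskiTrace.mul {p : ℕ} {f g : Polynomial ℚ} (hf : f.Monic) (hg : g.Monic)
    (h₁ : HasMinkowskiTrace p f) (h₂ : HasMinkowskiTrace p g) : HasMinkowskiTrace p (f * g) := by
  obtain ⟨i, hi, hi', hi''⟩ := h₁
  obtain ⟨j, hj, hj', hj''⟩ := h₂
  refine ⟨i + j, ?_, ?_, fun h => ?_⟩
  · rw [hf.nextCoeff_mul hg, hf.natDegree_mul hg]
    push_cast
    linarith
  · rw [hf.natDegree_mul hg, mul_add]
    omega
  · rw [hf.natDegree_mul hg, pow_add, ← hi'' (by omega), ← hj'' (by omega)]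

open Polynomial in
theorem nextCoeff_cyclotomic_prime {p : ℕ} (hp : p.Prime) : (cyclotomic p ℚ).nextCoeff = 1 := by
  have hd : (cyclotomic p ℚ).natDegree = p - 1 := by
    rw [natDegree_cyclotomic, Nat.totient_prime hp]
  have := hp.two_le
  rw [nextCoeff_of_natDegree_pos (by omega), hd]
  have := Fact.mk hp
  rw [cyclotomic_prime, finsetSum_coeff]
  simp only [coeff_X_pow]
  rw [Finset.sum_ite_eq, if_pos (by simp; omega)]

-- Φ_{p^j}(X) = Φ_{p^{j-1}}(X^p) has only exponents divisible by p, and its degree minus one is not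
-- divisible by p.
open Polynomial in
theorem nextCoeff_cyclotomic_prime_pow {p j : ℕ} (hp : p.Prime) (hj : 2 ≤ j) :
    (cyclotomic (p ^ j) ℚ).nextCoeff = 0 := by
  obtain ⟨j, rfl⟩ := Nat.exists_eq_add_of_le hj
  have hd : (cyclotomic (p ^ (2 + j)) ℚ).natDegree = p * (p ^ j * (p - 1)) := by
    rw [natDegree_cyclotomic, Nat.totient_prime_pow hp (by omega),
      show 2 + j - 1 = j + 1 by omega, pow_succ]
    ring
  have h2 := hp.two_le
  have hpos : 0 < p ^ j * (p - 1) := Nat.mul_pos (pow_pos hp.pos _) (by omega)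
  rw [nextCoeff_of_natDegree_pos (by rw [hd]; exact Nat.mul_pos hp.pos hpos), hd,
    show 2 + j = j + 1 + 1 by omega, pow_succ,
    ← cyclotomic_expand_eq_cyclotomic hp (dvd_pow_self p (by omega)), coeff_expand hp.pos, if_neg]
  intro h
  have h1 : p ∣ 1 := by
    have := Nat.dvd_sub (dvd_mul_right p (p ^ j * (p - 1))) h
    rwa [Nat.sub_sub_self (Nat.mul_pos hp.pos hpos)] at this
  exact hp.one_lt.ne' (Nat.dvd_one.mp h1)

open Polynomial in
theorem hasMinkowskiTrace_cyclotomic {p : ℕ} (hp : p.Prime) (j : ℕ) :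
    HasMinkowskiTrace p (cyclotomic (p ^ j) ℚ) := by
  have h2 := hp.two_le
  rcases j with _ | _ | j
  · refine ⟨0, ?_, by simp, ?_⟩
    · have : (X - 1 : ℚ[X]) = X - C 1 := by simp
      simp only [pow_zero, cyclotomic_one, this, nextCoeff_X_sub_C, natDegree_X_sub_C]
      simp
    · have : (X - 1 : ℚ[X]).natDegree = 1 := natDegree_X_sub_C (1 : ℚ)
      simp [this]
  · refine ⟨1, ?_, ?_, by simp⟩
    · rw [zero_add, pow_one, nextCoeff_cyclotomic_prime hp, natDegree_cyclotomic,
        Nat.totient_prime hp, Nat.cast_sub hp.one_le]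
      simp
    · rw [zero_add, pow_one, natDegree_cyclotomic, Nat.totient_prime hp, mul_one]
  -- The root sum is 0, so p * i must equal the degree p^(j+1) * (p - 1).
  · refine ⟨p ^ j * (p - 1), ?_, ?_, fun h => ?_⟩
    · rw [nextCoeff_cyclotomic_prime_pow hp (by omega), natDegree_cyclotomic,
        Nat.totient_prime_pow hp (by omega), show j + 1 + 1 - 1 = j + 1 by omega]
      push_cast
      ring
    · rw [natDegree_cyclotomic, Nat.totient_prime_pow hp (by omega),
        show j + 1 + 1 - 1 = j + 1 by omega, pow_succ, mul_comm (p - 1)]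
      gcongr
      omega
    · exact absurd h (Nat.mul_pos (pow_pos hp.pos _) (by omega)).ne'

-- Any complex root has order p^j, so its minimal polynomial is cyclotomic and splits off; root sums
-- add up.
open Polynomial in
theorem hasMinkowskiTrace_of_roots {p k : ℕ} (hp : p.Prime) (f : Polynomial ℚ) (hf : f.Monic)
    (hroots : ∀ z : ℂ, aeval z f = 0 → z ^ p ^ k = 1) : HasMinkowskiTrace p f := by
  induction hd : f.natDegree using Nat.strong_induction_on generalizing f with
  | _ d ih =>
    by_cases h0 : f.natDegree = 0
    · rw [hf.natDegree_eq_zero.mp h0]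
      exact hasMinkowskiTrace_one p
    obtain ⟨z, hz⟩ := IsAlgClosed.exists_aeval_eq_zero ℂ f
      (by rw [degree_eq_natDegree hf.ne_zero]; exact_mod_cast h0)
    obtain ⟨j, -, hj⟩ := (Nat.dvd_prime_pow hp).mp (orderOf_dvd_of_pow_eq_one (hroots z hz))
    have hprim : IsPrimitiveRoot z (p ^ j) := hj ▸ IsPrimitiveRoot.orderOf z
    have hdvd : cyclotomic (p ^ j) ℚ ∣ f := by
      rw [cyclotomic_eq_minpoly_rat hprim (pow_pos hp.pos _)]
      exact minpoly.dvd ℚ z hz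
    obtain ⟨g, rfl⟩ := hdvd
    have hc := cyclotomic.monic (p ^ j) ℚ
    have hg : g.Monic := hc.of_mul_monic_left hf
    refine (hasMinkowskiTrace_cyclotomic hp j).mul hc hg (ih g.natDegree ?_ g hg ?_ rfl)
    · have : 0 < (cyclotomic (p ^ j) ℚ).natDegree := by
        rw [natDegree_cyclotomic]
        exact Nat.totient_pos.mpr (pow_pos hp.pos _)
      rw [hc.natDegree_mul hg] at hd
      omega
    · intro w hw
      exact hroots w (by rw [map_mul, hw, mul_zero])

open Polynomial in
theorem Matrix.pow_eq_one_of_aeval_charpoly_eq_zero {n q : ℕ} {M : Matrix (Fin n) (Fin n) ℚ}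
    (hM : M ^ q = 1) {z : ℂ} (hz : aeval z M.charpoly = 0) : z ^ q = 1 := by
  set A := M.map (algebraMap ℚ ℂ) with hA
  have hAq : A ^ q = 1 := by
    rw [hA, ← RingHom.mapMatrix_apply, ← map_pow, hM, map_one]
  have hroot : z ∈ spectrum ℂ A := by
    rw [Matrix.mem_spectrum_iff_isRoot_charpoly, hA, Matrix.charpoly_map, IsRoot, eval_map_algebraMap]
    exact hz
  have := spectrum.pow_mem_pow A q hroot
  rw [hAq] at this
  rcases subsingleton_or_nontrivial (Matrix (Fin n) (Fin n) ℂ) with h | h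
  · simp [spectrum.of_subsingleton] at this
  · simpa [spectrum.one_eq] using this

-- The minimal polynomial divides the separable X^q - 1, so it is squarefree and a power of X - 1
-- collapses to X - 1.
open Polynomial in
theorem Matrix.eq_one_of_charpoly_eq {n q : ℕ} (hq : q ≠ 0) {M : Matrix (Fin n) (Fin n) ℚ}
    (hM : M ^ q = 1) {d : ℕ} (h : M.charpoly = (X - 1) ^ d) : M = 1 := by
  have h1 : minpoly ℚ M ∣ (X - 1) ^ d := h ▸ Matrix.minpoly_dvd_charpoly M
  have h2 : minpoly ℚ M ∣ X ^ q - C 1 := minpoly.dvd ℚ M (by simp [hM])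
  have h3 : Squarefree (minpoly ℚ M) :=
    (separable_X_pow_sub_C (1 : ℚ) (by exact_mod_cast hq) one_ne_zero).squarefree.squarefree_of_dvd h2
  have hd : minpoly ℚ M ∣ X - 1 := by
    rcases eq_or_ne d 0 with rfl | hd0
    · exact h1.trans (by simp)
    · exact (h3.dvd_pow_iff_dvd hd0).mp h1
  have := (minpoly.dvd_iff (A := ℚ) (x := M)).mp hd
  simpa [sub_eq_zero] using this

theorem Matrix.trace_of_pow_prime_pow_eq_one {n p k : ℕ} (hp : p.Prime)
    {M : Matrix (Fin n) (Fin n) ℚ} (hM : M ^ p ^ k = 1) :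
    ∃ i : ℕ, M.trace = n - p * i ∧ i ≤ n / (p - 1) ∧ (i = 0 → M = 1) := by
  obtain ⟨i, h1, h2, h3⟩ := hasMinkowskiTrace_of_roots hp M.charpoly M.charpoly_monic
    fun z hz => Matrix.pow_eq_one_of_aeval_charpoly_eq_zero hM hz
  rw [Matrix.charpoly_natDegree_eq_dim, Fintype.card_fin] at h1 h2
  have := hp.two_le
  refine ⟨i, by rw [Matrix.trace_eq_neg_charpoly_nextCoeff, h1], ?_, fun h =>
    Matrix.eq_one_of_charpoly_eq (pow_pos hp.pos k).ne' hM (h3 h)⟩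
  rw [Nat.le_div_iff_mul_le (by omega), mul_comm]
  exact h2

/-! ### Blichfeldt's divisibility for p-groups -/

section Blichfeldt

variable {G : Type} [Group G] {V : Type} [AddCommGroup V] [Module ℚ V] [FiniteDimensional ℚ V]

theorem Representation.exists_sum_character_eq [Fintype G] (ρ : Representation ℚ G V) :
    ∃ d : ℤ, ∑ g, ρ.character g = Nat.card G * d := by
  have hne : (Nat.card G : ℚ) ≠ 0 := by exact_mod_cast Nat.card_pos.ne'
  let _ := invertibleOfNonzero hne
  refine ⟨Module.finrank ℚ ρ.invariants, ?_⟩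
  have := ρ.card_inv_mul_sum_char_eq_finrank
  push_cast
  rw [← this, mul_inv_cancel_left₀ hne]

/-- Powers of a character are characters of tensor powers, and a character sums to the group order
times the dimension of the invariants. -/
theorem Representation.exists_sum_character_pow_eq [Fintype G] (ρ : Representation ℚ G V) (k : ℕ) :
    ∃ d : ℤ, ∑ g, ρ.character g ^ k = Nat.card G * d := by
  suffices h : ∃ (W : Type) (_ : AddCommGroup W) (_ : Module ℚ W) (_ : FiniteDimensional ℚ W)
      (σ : Representation ℚ G W), σ.character = ρ.character ^ k by
    obtain ⟨W, _, _, _, σ, hσ⟩ := h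
    simpa [hσ] using σ.exists_sum_character_eq
  induction k with
  | zero =>
    refine ⟨ℚ, inferInstance, inferInstance, inferInstance, Representation.trivial ℚ G ℚ, ?_⟩
    ext g
    simp [Representation.character, Representation.trivial]
  | succ k ih =>
    obtain ⟨W, _, _, _, σ, hσ⟩ := ih
    exact ⟨TensorProduct ℚ W V, inferInstance, inferInstance, inferInstance, σ.tprod ρ, by
      rw [Representation.char_tensor, hσ, pow_succ]⟩

theorem Representation.exists_sum_aeval_character_eq [Fintype G] (ρ : Representation ℚ G V)
    (f : Polynomial ℤ) :
    ∃ d : ℤ, ∑ g, Polynomial.aeval (ρ.character g) f = Nat.card G * d := by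
  choose d hd using ρ.exists_sum_character_pow_eq
  refine ⟨∑ i ∈ Finset.range (f.natDegree + 1), f.coeff i * d i, ?_⟩
  simp_rw [Polynomial.aeval_eq_sum_range]
  rw [Finset.sum_comm]
  push_cast
  rw [Finset.mul_sum]
  refine Finset.sum_congr rfl fun i _ => ?_
  rw [← Finset.smul_sum, hd, zsmul_eq_mul]
  ring

end Blichfeldt

theorem IsPGroup.card_dvd_of_injective_matrix {p n : ℕ} (hp : p.Prime) {G : Type} [Group G]
    [Finite G] (hG : IsPGroup p G) (φ : G →* Matrix (Fin n) (Fin n) ℚ)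
    (hφ : Function.Injective φ) :
    Nat.card G ∣ p ^ (n / (p - 1)) * (n / (p - 1)).factorial := by
  classical
  cases nonempty_fintype G
  set m := n / (p - 1) with hm
  let ρ : Representation ℚ G (Fin n → ℚ) :=
    ((Matrix.toLinAlgEquiv' : Matrix (Fin n) (Fin n) ℚ ≃ₐ[ℚ] _) : _ →* _).comp φ
  have hρ (g : G) : ρ.character g = (φ g).trace := Matrix.trace_toLin'_eq (φ g)
  -- The roots are the traces possible for non-identity elements; the shift i + 1 leaves out n, the
  -- trace of the identity.
  let f : Polynomial ℤ := ∏ i ∈ Finset.range m,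
    (Polynomial.X - Polynomial.C ((n : ℤ) - p * (i + 1 : ℕ)))
  have hf (g : G) : Polynomial.aeval (ρ.character g) f =
      ∏ i ∈ Finset.range m, ((φ g).trace - (n - p * (i + 1 : ℕ))) := by
    simp [f, hρ, map_prod]
  obtain ⟨d, hd⟩ := ρ.exists_sum_aeval_character_eq f
  have hsum : ∑ g, Polynomial.aeval (ρ.character g) f = (p : ℚ) ^ m * m.factorial := by
    rw [Finset.sum_eq_single 1]
    · rw [hf, map_one, Matrix.trace_one, Fintype.card_fin]
      simp only [sub_sub_cancel]
      rw [Finset.prod_mul_distrib, Finset.prod_const, Finset.card_range,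
        ← Finset.prod_range_add_one_eq_factorial, Nat.cast_prod]
    · intro g _ hg
      obtain ⟨k, hk⟩ := hG g
      obtain ⟨i, h1, h2, h3⟩ := Matrix.trace_of_pow_prime_pow_eq_one hp (M := φ g) (k := k)
        (by rw [← map_pow, hk, map_one])
      obtain ⟨i, rfl⟩ := Nat.exists_eq_succ_of_ne_zero fun h : i = 0 =>
        hg (hφ (by rw [h3 h, map_one]))
      rw [hf]
      exact Finset.prod_eq_zero (Finset.mem_range.mpr h2)
        (by rw [h1, sub_self])
    · simp
  rw [hsum] at hd
  have : (Nat.card G : ℤ) ∣ (p ^ m * m.factorial : ℕ) := ⟨d, by exact_mod_cast hd⟩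
  exact_mod_cast this

/-! ### Prime factorization of M(n) and the upper bound -/

/-- Nested floors turn the terms into ⌊m/p^k⌋: the factor p^m gives the term k = 0, Legendre's
formula for m! the others. -/
theorem minkowskiExponent_eq_factorization (n : ℕ) {p : ℕ} (hp : p.Prime) :
    minkowskiExponent n p =
      (p ^ (n / (p - 1)) * (n / (p - 1)).factorial).factorization p := by
  have := Fact.mk hp
  set m := n / (p - 1) with hm
  have hmn : m ≤ n := Nat.div_le_self _ _
  rw [minkowskiExponent_eq_sum n hp, Nat.factorization_mul (pow_pos hp.pos _).ne'
    (Nat.factorial_ne_zero _), Finsupp.add_apply, hp.factorization_pow, Finsupp.single_eq_same,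
    Nat.factorization_def _ hp, padicValNat_factorial (b := n + 1)
      ((Nat.log_le_self p m).trans_lt (by omega))]
  have hterm (k : ℕ) : n / (p ^ k * (p - 1)) = m / p ^ k := by
    rw [mul_comm, ← Nat.div_div_eq_div_mul]
  have hlast : m / p ^ n = 0 := Nat.div_eq_of_lt (hmn.trans_lt (Nat.lt_pow_self hp.one_lt))
  calc ∑ k ∈ Finset.range n, n / (p ^ k * (p - 1)) = ∑ k ∈ Finset.range (n + 1), m / p ^ k := by
        rw [Finset.sum_range_succ, hlast, add_zero]
        exact Finset.sum_congr rfl fun k _ => hterm k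
    _ = m + ∑ k ∈ Finset.Ico 1 (n + 1), m / p ^ k := by
        rw [Finset.range_eq_Ico, Finset.sum_eq_sum_Ico_succ_bot (by omega)]
        simp

theorem minkowskiNumber_eq_prod (n : ℕ) : ∃ s : Finset Nat.Primes,
    minkowskiNumber n = ∏ p ∈ s, (p : ℕ) ^ minkowskiExponent n p ∧
      ∀ p ∉ s, minkowskiExponent n p = 0 := by
  refine ⟨(minkowskiNumber_finite_mulSupport n).toFinset,
    finprod_eq_prod _ (minkowskiNumber_finite_mulSupport n), fun p hp => ?_⟩
  have : (p : ℕ) ^ minkowskiExponent n p = 1 := by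
    simpa only [Set.Finite.mem_toFinset, Function.mem_mulSupport, not_not] using hp
  exact (Nat.pow_eq_one.mp this).resolve_left p.2.one_lt.ne'

theorem pow_minkowskiExponent_dvd_minkowskiNumber (n : ℕ) {p : ℕ} (hp : p.Prime) :
    p ^ minkowskiExponent n p ∣ minkowskiNumber n := by
  obtain ⟨s, hs, hs'⟩ := minkowskiNumber_eq_prod n
  by_cases h : (⟨p, hp⟩ : Nat.Primes) ∈ s
  · rw [hs]
    exact Finset.dvd_prod_of_mem (fun q : Nat.Primes => (q : ℕ) ^ minkowskiExponent n q) h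
  · rw [hs' ⟨p, hp⟩ h, pow_zero]
    exact one_dvd _

theorem minkowskiNumber_dvd {n k : ℕ}
    (h : ∀ p : ℕ, p.Prime → p ^ minkowskiExponent n p ∣ k) : minkowskiNumber n ∣ k := by
  obtain ⟨s, hs, -⟩ := minkowskiNumber_eq_prod n
  rw [hs]
  refine Finset.prod_dvd_of_isRelPrime (fun p _ q _ hpq => ?_) fun p _ => h p p.2
  exact Nat.coprime_iff_isRelPrime.mp (Nat.Coprime.pow _ _
    ((Nat.coprime_primes p.2 q.2).mpr (Subtype.val_injective.ne hpq)))

theorem card_dvd_minkowskiNumber {n : ℕ} (G : Subgroup (Matrix.GeneralLinearGroup (Fin n) ℚ))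
    [Finite G] : Nat.card G ∣ minkowskiNumber n := by
  rw [Nat.dvd_iff_prime_pow_dvd_dvd]
  intro p k hp hk
  have := Fact.mk hp
  refine (pow_dvd_pow p ?_).trans (pow_minkowskiExponent_dvd_minkowskiNumber n hp)
  obtain ⟨H, hH⟩ := Sylow.exists_subgroup_card_pow_prime p hk
  let φ : H →* Matrix (Fin n) (Fin n) ℚ :=
    (Units.coeHom _).comp (G.subtype.comp H.subtype)
  have hφ : Function.Injective φ :=
    Units.val_injective.comp (Subtype.val_injective.comp Subtype.val_injective)
  have := (IsPGroup.of_card hH).card_dvd_of_injective_matrix hp φ hφ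
  rw [hH] at this
  rw [minkowskiExponent_eq_factorization n hp]
  exact (hp.pow_dvd_iff_le_factorization
    (Nat.mul_ne_zero (pow_pos hp.pos _).ne' (Nat.factorial_ne_zero _))).mp this

/-! ### Monomial groups attaining the bound -/

/-- The monomial action of `(Fin m → rootsOfUnity p K) ⋊ Perm (Fin m)` on `K ^ m`, extended by the
trivial action on `ℚ ^ r`. -/
def monomialHom (p m r : ℕ) (K : Type) [Field K] [Algebra ℚ K] :
    ((Fin m → rootsOfUnity p K) ⋊[mulAutArrow] Equiv.Perm (Fin m)) →*
      Module.End ℚ ((Fin m → K) × (Fin r → ℚ)) where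
  toFun h :=
    { toFun := fun v => (fun i => ((h.left i : Kˣ) : K) * v.1 (h.right⁻¹ i), v.2)
      map_add' := fun v w => by ext <;> simp [mul_add]
      map_smul' := fun c v => by ext <;> simp }
  map_one' := by ext <;> simp
  map_mul' g h := by
    refine LinearMap.ext fun v => Prod.ext (funext fun i => ?_) rfl
    change (((g.left i * h.left (g.right⁻¹ i) : rootsOfUnity p K) : Kˣ) : K) *
      v.1 ((g.right * h.right)⁻¹ i) = _
    simp [mul_assoc]

theorem monomialHom_injective (p m r : ℕ) (K : Type) [Field K] [Algebra ℚ K] :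
    Function.Injective (monomialHom p m r K) := by
  intro g h hgh
  have key (v : Fin m → K) (i : Fin m) : ((g.left i : Kˣ) : K) * v (g.right⁻¹ i) =
      ((h.left i : Kˣ) : K) * v (h.right⁻¹ i) :=
    congrFun (congrArg Prod.fst (LinearMap.congr_fun hgh (v, 0))) i
  refine SemidirectProduct.ext (funext fun i => ?_) ?_
  -- The all-ones vector reads off the diagonal part; below, a basis vector detects the permutation.
  · have := key 1 i
    simp only [Pi.one_apply, mul_one] at this
    exact Subtype.ext (Units.ext this)
  · refine inv_injective (Equiv.ext fun i => ?_)
    by_contra hne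
    have := key (Pi.single (g.right⁻¹ i) 1) i
    rw [Pi.single_eq_same, Pi.single_eq_of_ne (Ne.symm hne), mul_zero, mul_one] at this
    exact (g.left i : Kˣ).ne_zero this

theorem exists_subgroup_card_eq_of_injective {n : ℕ} {H V : Type} [Group H] [AddCommGroup V]
    [Module ℚ V] [FiniteDimensional ℚ V] (hV : Module.finrank ℚ V = n) (φ : H →* Module.End ℚ V)
    (hφ : Function.Injective φ) :
    ∃ G : Subgroup (Matrix.GeneralLinearGroup (Fin n) ℚ), Nat.card G = Nat.card H := by
  let e := algEquivMatrix (Module.finBasisOfFinrankEq ℚ V hV)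
  let ψ : H →* Matrix.GeneralLinearGroup (Fin n) ℚ := ((e : _ →* _).comp φ).toHomUnits
  have hψ : Function.Injective ψ := fun g h hgh => hφ (e.injective (congrArg Units.val hgh))
  exact ⟨ψ.range, (Nat.card_congr (MonoidHom.ofInjective hψ).toEquiv).symm⟩

theorem exists_subgroup_card_eq_pow_mul_factorial (n : ℕ) {p : ℕ} (hp : p.Prime) :
    ∃ G : Subgroup (Matrix.GeneralLinearGroup (Fin n) ℚ), Finite G ∧
      Nat.card G = p ^ (n / (p - 1)) * (n / (p - 1)).factorial := by
  have : NeZero p := ⟨hp.ne_zero⟩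
  obtain ⟨K, _, _, _⟩ : ∃ (K : Type) (_ : Field K) (_ : Algebra ℚ K),
      IsCyclotomicExtension {p} ℚ K :=
    ⟨CyclotomicField p ℚ, inferInstance, CyclotomicField.algebra p ℚ, inferInstance⟩
  have := IsCyclotomicExtension.finiteDimensional {p} ℚ K
  have hK : Module.finrank ℚ K = p - 1 := by
    rw [IsCyclotomicExtension.finrank K (Polynomial.cyclotomic.irreducible_rat hp.pos),
      Nat.totient_prime hp]
  obtain ⟨m, hm⟩ : ∃ m, m = n / (p - 1) := ⟨_, rfl⟩
  have hle : m * (p - 1) ≤ n := hm ▸ Nat.div_mul_le_self n (p - 1)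
  have hV : Module.finrank ℚ ((Fin m → K) × (Fin (n - m * (p - 1)) → ℚ)) = n := by
    rw [Module.finrank_prod, Module.finrank_pi_fintype, Module.finrank_fin_fun]
    simp only [hK, Finset.sum_const, Finset.card_univ, Fintype.card_fin, smul_eq_mul]
    omega
  obtain ⟨G, hG⟩ := exists_subgroup_card_eq_of_injective hV
    (monomialHom p m (n - m * (p - 1)) K) (monomialHom_injective _ _ _ _)
  have hcard : Nat.card G = p ^ m * m.factorial := by
    rw [hG, SemidirectProduct.card, Nat.card_fun, Nat.card_perm,
      (IsCyclotomicExtension.zeta_spec p ℚ K).card_rootsOfUnity, Nat.card_fin]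
  refine ⟨G, Nat.finite_of_card_ne_zero ?_, hm ▸ hcard⟩
  rw [hcard]
  exact Nat.mul_ne_zero (pow_pos hp.pos _).ne' (Nat.factorial_ne_zero _)

theorem mainTheorem2 (n : ℕ) :
    IsSetLCM (finiteRationalMatrixGroupOrders n) (minkowskiNumber n) := by
  refine ⟨?_, fun k hk => minkowskiNumber_dvd fun p hp => ?_⟩
  · rintro _ ⟨G, hG, rfl⟩
    exact card_dvd_minkowskiNumber G
  · obtain ⟨G, hG, hcard⟩ := exists_subgroup_card_eq_pow_mul_factorial n hp
    refine dvd_trans ?_ (hcard ▸ hk _ ⟨G, hG, rfl⟩)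
    rw [minkowskiExponent_eq_factorization n hp]
    -- Only the p-part of the order p^m * m! is needed.
    exact Nat.ordProj_dvd _ p
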